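/- The following is a theorem of $\mathrm{ZF}$ (Zermelo--Fraenkel set theory without the axiom of choice), that is, it holds in every model of the first-order theory $\mathrm{ZF}$. Let $\kappa\in On$ be an uncountable cardinal (an initial ordinal that cannot be injected into $\omega$), and let $F:\kappa\to[\kappa]^{<\omega}$ be a function assigning to each $\alpha<\kappa$ a finite subset $F(\alpha)$ of $\kappa$. Call $X\subseteq\kappa$ *$F$-free* if $\alpha\notin F(\beta)$ for all distinct $\alpha,\beta\in X$. Then: 1. there is an $F$-free set $A\subseteq\kappa$ with $|A|=\omega$; and 2. $\kappa$ can be partitioned into $\omega$-many $F$-free sets: there is a set $P$ with $|P|=\omega$ of nonempty, pairwise disjoint, $F$-free sets whose union is $\kappa$. -/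

import Mathlib

/-! Models of Zermelo–Fraenkel set theory (without choice) as first-order structures, and the
notions of infinite combinatorics interpreted inside such a model: every quantifier over sets
ranges over the elements of the model, and the schemes of separation and replacement are
postulated for first-order formulas with parameters. -/

/-- The relation symbols of the language of set theory: one binary symbol. -/
inductive MemSymbol : ℕ → Type
  | mem : MemSymbol 2

/-- The first-order language of set theory, `{∈}` (equality is logical). -/
def setLang : FirstOrder.Language.{0, 0} := ⟨fun _ => Empty, MemSymbol⟩

namespace ZFModel

variable {M : Type*} [setLang.Structure M]

/-- The membership relation of the structure `M`. -/
def Mem (x y : M) : Prop :=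
  FirstOrder.Language.Structure.RelMap (L := setLang) (M := M) (n := 2) MemSymbol.mem ![x, y]

infix:50 " ∈ₘ " => Mem

/-- `x ⊆ y`. -/
def Incl (x y : M) : Prop := ∀ z : M, z ∈ₘ x → z ∈ₘ y

/-- `p = {x, y}`. -/
def IsUPair (p x y : M) : Prop := ∀ z : M, z ∈ₘ p ↔ z = x ∨ z = y

/-- `s = x ∪ {x}`. -/
def IsSucc (s x : M) : Prop := ∀ z : M, z ∈ₘ s ↔ z ∈ₘ x ∨ z = x

/-- `w` contains the empty set and is closed under `x ↦ x ∪ {x}`. -/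
def IsInductive (w : M) : Prop :=
  (∃ e : M, e ∈ₘ w ∧ ∀ z : M, ¬ z ∈ₘ e) ∧
    ∀ x : M, x ∈ₘ w → ∃ s : M, s ∈ₘ w ∧ IsSucc s x

/-- The structure `M` satisfies all axioms of Zermelo–Fraenkel set theory `ZF`
(no axiom of choice). -/
class ModelsZF (M : Type*) [setLang.Structure M] : Prop where
  extensionality : ∀ x y : M, (∀ z : M, z ∈ₘ x ↔ z ∈ₘ y) → x = y
  foundation : ∀ x : M, (∃ y : M, y ∈ₘ x) → ∃ y : M, y ∈ₘ x ∧ ∀ z : M, z ∈ₘ x → ¬ z ∈ₘ y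
  pairing : ∀ x y : M, ∃ p : M, IsUPair p x y
  union : ∀ x : M, ∃ u : M, ∀ z : M, z ∈ₘ u ↔ ∃ y : M, y ∈ₘ x ∧ z ∈ₘ y
  powerset : ∀ x : M, ∃ p : M, ∀ z : M, z ∈ₘ p ↔ Incl z x
  infinity : ∃ w : M, IsInductive w
  /-- One axiom for each first-order formula `φ(x, p₁, …, pₙ)`. -/
  separation : ∀ (n : ℕ) (φ : setLang.Formula (Fin (n + 1))) (p : Fin n → M) (a : M),
    ∃ b : M, ∀ x : M, x ∈ₘ b ↔ x ∈ₘ a ∧ φ.Realize (Fin.cons x p : Fin (n + 1) → M)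
  /-- One axiom for each first-order formula `φ(x, y, p₁, …, pₙ)`: if it defines a (partial) class
  function `x ↦ y`, then the image of every set is a set. -/
  replacement : ∀ (n : ℕ) (φ : setLang.Formula (Fin (n + 2))) (p : Fin n → M),
    (∀ x y z : M, φ.Realize (Fin.cons x (Fin.cons y p : Fin (n + 1) → M) : Fin (n + 2) → M) →
      φ.Realize (Fin.cons x (Fin.cons z p : Fin (n + 1) → M) : Fin (n + 2) → M) → y = z) →
    ∀ a : M, ∃ b : M, ∀ y : M, y ∈ₘ b ↔
      ∃ x : M, x ∈ₘ a ∧ φ.Realize (Fin.cons x (Fin.cons y p : Fin (n + 1) → M) : Fin (n + 2) → M)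

/-- `w = ω`, the least inductive set. -/
def IsOmega (w : M) : Prop := IsInductive w ∧ ∀ v : M, IsInductive v → Incl w v

/-- `p = (x, y)`, the Kuratowski pair `{{x}, {x, y}}`. -/
def IsOPair (p x y : M) : Prop := ∀ z : M, z ∈ₘ p ↔ IsUPair z x x ∨ IsUPair z x y

/-- `(x, y) ∈ f`, that is, `f(x) = y` when `f` is a function. -/
def App (f x y : M) : Prop := ∃ p : M, IsOPair p x y ∧ p ∈ₘ f

/-- `f : a → b`, with `f` an element of the model. -/
def IsFun (f a b : M) : Prop :=
  (∀ p : M, p ∈ₘ f → ∃ x y : M, x ∈ₘ a ∧ y ∈ₘ b ∧ IsOPair p x y) ∧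
    ∀ x : M, x ∈ₘ a → ∃! y : M, App f x y

/-- `f : a → b` is injective. -/
def IsInj (f a b : M) : Prop :=
  IsFun f a b ∧ ∀ x x' y : M, App f x y → App f x' y → x = x'

/-- `f : a → b` is bijective. -/
def IsBij (f a b : M) : Prop := IsInj f a b ∧ ∀ y : M, y ∈ₘ b → ∃ x : M, App f x y

/-- `|a| = |b|`. -/
def Equinum (a b : M) : Prop := ∃ f : M, IsBij f a b

/-- `a` is countable: it can be injected into `ω`. -/
def IsCountable (a : M) : Prop := ∃ w f : M, IsOmega w ∧ IsInj f a w

/-- `a` is a von Neumann ordinal: transitive and linearly ordered by `∈` (well-foundedness is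
part of the axiom of foundation). -/
def IsOrdinal (a : M) : Prop :=
  (∀ x : M, x ∈ₘ a → Incl x a) ∧
    ∀ x y : M, x ∈ₘ a → y ∈ₘ a → x ∈ₘ y ∨ x = y ∨ y ∈ₘ x

/-- `κ ∈ On` is a cardinal: an ordinal not equinumerous with a smaller one. -/
def IsCardinal (κ : M) : Prop := IsOrdinal κ ∧ ∀ β : M, β ∈ₘ κ → ¬ Equinum β κ

/-- `|a| < μ`, for a cardinal `μ ∈ On`. -/
def CardLt (a μ : M) : Prop := ∃ β : M, β ∈ₘ μ ∧ Equinum a β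

/-- `s = [κ]^{<μ}`, the set of all subsets of `κ` of cardinality less than `μ`. -/
def IsSmallSubsets (s κ μ : M) : Prop := ∀ a : M, a ∈ₘ s ↔ Incl a κ ∧ CardLt a μ

/-- `F : κ → [κ]^{<μ}`. -/
def IsSetMapping (F κ μ : M) : Prop := ∃ s : M, IsSmallSubsets s κ μ ∧ IsFun F κ s

/-- `X ⊆ κ` is `F`-free: `α ∉ F(β)` for all distinct `α, β ∈ X`. -/
def IsFree (F κ X : M) : Prop :=
  Incl X κ ∧ ∀ α β : M, α ∈ₘ X → β ∈ₘ X → α ≠ β → ∀ y : M, App F β y → ¬ α ∈ₘ y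

/-- `P` is a partition of `a` into nonempty, pairwise disjoint sets. -/
def IsPartition (P a : M) : Prop :=
  (∀ X : M, X ∈ₘ P → ∃ x : M, x ∈ₘ X) ∧
  (∀ X Y : M, X ∈ₘ P → Y ∈ₘ P → X ≠ Y → ∀ x : M, x ∈ₘ X → ¬ x ∈ₘ Y) ∧
  ∀ x : M, x ∈ₘ a ↔ ∃ X : M, X ∈ₘ P ∧ x ∈ₘ X

/-- `Free(κ ↦ [κ]^{<μ}, ν)`: every set mapping `F : κ → [κ]^{<μ}` has an `F`-free set of
cardinality `ν`. -/
def Free (κ μ ν : M) : Prop :=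
  ∀ F : M, IsSetMapping F κ μ → ∃ A : M, IsFree F κ A ∧ Equinum A ν

/-- `FreeUnion(κ ↦ [κ]^{<μ}, ν)`: for every set mapping `F : κ → [κ]^{<μ}`, the set `κ` can be
partitioned into `ν`-many `F`-free sets. -/
def FreeUnion (κ μ ν : M) : Prop :=
  ∀ F : M, IsSetMapping F κ μ →
    ∃ P : M, IsPartition P κ ∧ Equinum P ν ∧ ∀ X : M, X ∈ₘ P → IsFree F κ X

end ZFModel

/-! Read `η ∈ F(ξ)` as an arrow from ξ to η. Every point has finitely many outgoing arrows, and the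
free sets are the independent sets of the underlying graph, so the task is to colour this graph by ω
without choice. The points reachable from α in at most n steps form a finite set. Rank ξ by the
least α that reaches it, then by the distance n, then by ξ itself. An earlier neighbour η of ξ is
either a target of ξ, or has an arrow to ξ. In the second case whatever reaches η reaches ξ, so both
have the same α and η lies in the ball around α with the distance of ξ as radius. Thus each point
has finitely many earlier neighbours, and always taking the least free colour works
(`exists_greedy`, `exists_coloring`).

To make all of ω occur as colours, extra arrows turn an infinite subset of κ into a clique while
keeping out-degrees finite (`exists_free_coloring`); the colour classes then form the partition.
Were all classes finite, ordering κ by colour and then by membership would give finite initial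
segments and inject κ into ω (`exists_infinite_fibre`). So some class is infinite, and its members
with finitely many predecessors in it form a free set of size ω.

Everything constructed must be an element of the model; `Dfb` lets instance search find the formulas
that separation needs. -/

namespace ZFModel

/-! ### First-order definability by instance search. -/

variable {M : Type*} [setLang.Structure M]

/-- The membership symbol as a relation symbol of `setLang`. -/
def memRel : setLang.Relations 2 := MemSymbol.mem

/-- `f` is a variable or a constant, as a function of the valuation of the variables. -/
class IsAtomicTerm (f : (ℕ → M) → M) : Prop where
  exists_eq : ∃ t : M ⊕ ℕ, ∀ v, f v = Sum.elim id v t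

/-- The predicate `P` of valuations is first-order definable with parameters. -/
class Dfb (P : (ℕ → M) → Prop) : Prop where
  exists_formula : ∃ φ : setLang.Formula (M ⊕ ℕ), ∀ v, P v ↔ φ.Realize (Sum.elim id v)

instance IsAtomicTerm.var (k : ℕ) : IsAtomicTerm (fun v : ℕ → M => v k) := ⟨.inr k, fun _ => rfl⟩

instance IsAtomicTerm.const (a : M) : IsAtomicTerm (fun _ : ℕ → M => a) := ⟨.inl a, fun _ => rfl⟩

/-- Passing under a quantifier shifts the variables, so terms reappear precomposed with a
reindexing. -/
instance IsAtomicTerm.reindex (f : (ℕ → M) → M) (g : ℕ → ℕ) [hf : IsAtomicTerm f] :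
    IsAtomicTerm (fun v => f (fun i => v (g i))) := by
  obtain ⟨t, ht⟩ := hf.exists_eq
  refine ⟨t.map id g, fun v => ?_⟩
  rw [ht]
  cases t <;> rfl

namespace Dfb

variable {P Q : (ℕ → M) → Prop}

instance mem (f g : (ℕ → M) → M) [hf : IsAtomicTerm f] [hg : IsAtomicTerm g] :
    Dfb (fun v => f v ∈ₘ g v) := by
  obtain ⟨t, ht⟩ := hf.exists_eq
  obtain ⟨s, hs⟩ := hg.exists_eq
  refine ⟨memRel.formula₂ (.var t) (.var s), fun v => ?_⟩
  rw [ht, hs, FirstOrder.Language.Formula.realize_rel₂]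
  rfl

instance eq (f g : (ℕ → M) → M) [hf : IsAtomicTerm f] [hg : IsAtomicTerm g] :
    Dfb (fun v => f v = g v) := by
  obtain ⟨t, ht⟩ := hf.exists_eq
  obtain ⟨s, hs⟩ := hg.exists_eq
  refine ⟨FirstOrder.Language.Term.equal (.var t) (.var s), fun v => ?_⟩
  rw [ht, hs, FirstOrder.Language.Formula.realize_equal]
  rfl

instance not [hP : Dfb P] : Dfb (fun v => ¬ P v) := by
  obtain ⟨φ, hφ⟩ := hP.exists_formula
  exact ⟨φ.not, fun v => by rw [hφ]; exact FirstOrder.Language.Formula.realize_not.symm⟩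

instance imp [hP : Dfb P] [hQ : Dfb Q] : Dfb (fun v => P v → Q v) := by
  obtain ⟨φ, hφ⟩ := hP.exists_formula
  obtain ⟨ψ, hψ⟩ := hQ.exists_formula
  exact ⟨φ.imp ψ, fun v => by
    rw [hφ, hψ]; exact FirstOrder.Language.Formula.realize_imp.symm⟩

instance and [hP : Dfb P] [hQ : Dfb Q] : Dfb (fun v => P v ∧ Q v) := by
  have h : Dfb (fun v => ¬ (P v → ¬ Q v)) := inferInstance
  simpa using h

instance or [hP : Dfb P] [hQ : Dfb Q] : Dfb (fun v => P v ∨ Q v) := by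
  have h : Dfb (fun v => ¬ P v → Q v) := inferInstance
  simpa only [or_iff_not_imp_left] using h

instance iff [hP : Dfb P] [hQ : Dfb Q] : Dfb (fun v => P v ↔ Q v) := by
  have h : Dfb (fun v => (P v → Q v) ∧ (Q v → P v)) := inferInstance
  simpa only [iff_def] using h

instance all (P : (ℕ → M) → M → Prop) [hP : Dfb (fun v => P (fun i => v (i + 1)) (v 0))] :
    Dfb (fun v => ∀ x, P v x) := by
  obtain ⟨φ, hφ⟩ := hP.exists_formula
  -- Variable 0 becomes the bound variable and variable `k + 1` becomes the outer variable `k`.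
  let g : M ⊕ ℕ → (M ⊕ ℕ) ⊕ Unit :=
    Sum.elim (fun a => .inl (.inl a)) (fun k => k.casesOn (.inr ()) (fun k => .inl (.inr k)))
  refine ⟨(φ.relabel g).iAlls Unit, fun v => ?_⟩
  rw [FirstOrder.Language.Formula.realize_iAlls]
  have key : ∀ x : M, P v x ↔ (φ.relabel g).Realize (Sum.elim (Sum.elim id v) fun _ => x) := by
    intro x
    have h := hφ (fun k => k.casesOn x v)
    rw [FirstOrder.Language.Formula.realize_relabel]
    change P v x ↔ _ at h
    convert h using 2
    funext t
    rcases t with a | k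
    · rfl
    · cases k <;> rfl
  exact ⟨fun h i => (key _).1 (h (i ())), fun h x => (key x).2 (h fun _ => x)⟩

instance ex (P : (ℕ → M) → M → Prop) [hP : Dfb (fun v => P (fun i => v (i + 1)) (v 0))] :
    Dfb (fun v => ∃ x, P v x) := by
  have h : Dfb (fun v => ¬ ∀ x, ¬ P v x) := inferInstance
  simpa using h

instance isUPair (f g h : (ℕ → M) → M) [IsAtomicTerm f] [IsAtomicTerm g] [IsAtomicTerm h] :
    Dfb (fun v => IsUPair (f v) (g v) (h v)) := by unfold IsUPair; infer_instance

instance isOPair (f g h : (ℕ → M) → M) [IsAtomicTerm f] [IsAtomicTerm g] [IsAtomicTerm h] :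
    Dfb (fun v => IsOPair (f v) (g v) (h v)) := by unfold IsOPair; infer_instance

instance app (f g h : (ℕ → M) → M) [IsAtomicTerm f] [IsAtomicTerm g] [IsAtomicTerm h] :
    Dfb (fun v => App (f v) (g v) (h v)) := by unfold App; infer_instance

instance isSucc (f g : (ℕ → M) → M) [IsAtomicTerm f] [IsAtomicTerm g] :
    Dfb (fun v => IsSucc (f v) (g v)) := by unfold IsSucc; infer_instance

instance isInductive (f : (ℕ → M) → M) [IsAtomicTerm f] :
    Dfb (fun v => IsInductive (f v)) := by unfold IsInductive; infer_instance

/-- For an abstract relation definability is assumed only at the variables 0 and 1; this transports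
it to all atomic arguments, as needed under quantifiers. -/
theorem subst₂ (Q : M → M → Prop) [hQ : Dfb (fun v => Q (v 0) (v 1))] (f g : (ℕ → M) → M)
    [hf : IsAtomicTerm f] [hg : IsAtomicTerm g] : Dfb (fun v => Q (f v) (g v)) := by
  obtain ⟨φ, hφ⟩ := hQ.exists_formula
  obtain ⟨t, ht⟩ := hf.exists_eq
  obtain ⟨s, hs⟩ := hg.exists_eq
  let r : M ⊕ ℕ → M ⊕ ℕ := Sum.elim .inl (fun k => k.casesOn t (fun _ => s))
  refine ⟨φ.relabel r, fun v => ?_⟩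
  have h := hφ (fun k => k.casesOn (f v) (fun _ => g v))
  rw [FirstOrder.Language.Formula.realize_relabel]
  change Q (f v) (g v) ↔ _ at h
  convert h using 2
  funext u
  rcases u with a | k
  · rfl
  · cases k
    · exact (ht v).symm
    · exact (hs v).symm

end Dfb

/-! ### Separation, pairs and definable relations inside the model. -/

variable [ModelsZF M]

theorem exists_sep (P : M → Prop) [hP : Dfb (fun v => P (v 0))] (a : M) :
    ∃ b : M, ∀ x : M, x ∈ₘ b ↔ x ∈ₘ a ∧ P x := by
  classical
  obtain ⟨φ, hφ⟩ := hP.exists_formula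
  let s := FirstOrder.Language.BoundedFormula.freeVarFinset (L := setLang) (α := M ⊕ ℕ) (n := 0) φ
  -- All variables go to slot 0, which holds `x`; constants go to parameter slots. The value `a` in
  -- `p` at a variable is a filler that is never read.
  let f : s → Fin (s.card + 1) := fun t => Sum.elim (fun _ => (s.equivFin t).succ) (fun _ => 0) t.1
  let p : Fin s.card → M := fun i => Sum.elim id (fun _ => a) (s.equivFin.symm i).1
  obtain ⟨b, hb⟩ := ModelsZF.separation s.card
    (FirstOrder.Language.BoundedFormula.restrictFreeVar φ f) p a
  refine ⟨b, fun x => (hb x).trans (and_congr_right fun _ => ?_)⟩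
  rw [hφ (fun _ => x)]
  refine FirstOrder.Language.BoundedFormula.realize_restrictFreeVar
    (L := setLang) (φ := φ) (f := f) (Sum.elim id fun _ => x) ?_
  rintro ⟨t, ht⟩
  rcases t with m | k
  · simp [f, p]
  · simp [f]

theorem ext {x y : M} (h : ∀ z : M, z ∈ₘ x ↔ z ∈ₘ y) : x = y := ModelsZF.extensionality x y h

theorem exists_minimal (P : M → Prop) [Dfb (fun v => P (v 0))] {a x : M} (hx : x ∈ₘ a) (hP : P x) :
    ∃ y, y ∈ₘ a ∧ P y ∧ ∀ z, z ∈ₘ a → P z → ¬ z ∈ₘ y := by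
  obtain ⟨b, hb⟩ := exists_sep P a
  obtain ⟨y, hy, hmin⟩ := ModelsZF.foundation b ⟨x, (hb x).2 ⟨hx, hP⟩⟩
  exact ⟨y, ((hb y).1 hy).1, ((hb y).1 hy).2, fun z hz hPz => hmin z ((hb z).2 ⟨hz, hPz⟩)⟩

theorem exists_empty : ∃ e : M, ∀ z : M, ¬ z ∈ₘ e := by
  obtain ⟨w, ⟨e, -, he⟩, -⟩ := ModelsZF.infinity (M := M)
  exact ⟨e, he⟩

theorem exists_union (x y : M) : ∃ u : M, ∀ z : M, z ∈ₘ u ↔ z ∈ₘ x ∨ z ∈ₘ y := by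
  obtain ⟨p, hp⟩ := ModelsZF.pairing x y
  obtain ⟨u, hu⟩ := ModelsZF.union p
  refine ⟨u, fun z => (hu z).trans ?_⟩
  simp [hp _, or_and_right, exists_or]

theorem exists_insert (x u : M) : ∃ y : M, ∀ z : M, z ∈ₘ y ↔ z ∈ₘ x ∨ z = u := by
  obtain ⟨p, hp⟩ := ModelsZF.pairing u u
  obtain ⟨y, hy⟩ := exists_union x p
  exact ⟨y, fun z => by rw [hy, hp, or_self]⟩

theorem mem_asymm {x y : M} (h : x ∈ₘ y) : ¬ y ∈ₘ x := by
  intro h'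
  obtain ⟨p, hp⟩ := ModelsZF.pairing x y
  obtain ⟨z, hz, hmin⟩ := ModelsZF.foundation p ⟨x, (hp x).2 (.inl rfl)⟩
  rcases (hp z).1 hz with rfl | rfl
  · exact hmin y ((hp _).2 (.inr rfl)) h'
  · exact hmin x ((hp _).2 (.inl rfl)) h

theorem mem_irrefl (x : M) : ¬ x ∈ₘ x := fun h => mem_asymm h h

theorem exists_isUPair (x y : M) : ∃ p : M, IsUPair p x y := ModelsZF.pairing x y

theorem IsUPair.unique {p q x y : M} (hp : IsUPair p x y) (hq : IsUPair q x y) : p = q :=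
  ext fun z => (hp z).trans (hq z).symm

theorem exists_isOPair (x y : M) : ∃ p : M, IsOPair p x y := by
  obtain ⟨s, hs⟩ := exists_isUPair x x
  obtain ⟨t, ht⟩ := exists_isUPair x y
  obtain ⟨p, hp⟩ := exists_isUPair s t
  refine ⟨p, fun z => (hp z).trans (or_congr ⟨?_, fun h => h.unique hs⟩ ⟨?_, fun h => h.unique ht⟩)⟩
  · rintro rfl; exact hs
  · rintro rfl; exact ht

theorem IsOPair.unique {p q x y : M} (hp : IsOPair p x y) (hq : IsOPair q x y) : p = q :=
  ext fun z => (hp z).trans (hq z).symm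

theorem IsOPair.inj {p x y x' y' : M} (h : IsOPair p x y) (h' : IsOPair p x' y') :
    x = x' ∧ y = y' := by
  obtain ⟨s, hs⟩ := exists_isUPair x x
  obtain ⟨t, ht⟩ := exists_isUPair x y
  obtain ⟨s', hs'⟩ := exists_isUPair x' x'
  obtain ⟨t', ht'⟩ := exists_isUPair x' y'
  have hx : x = x' := by
    rcases (h' s).1 ((h s).2 (.inl hs)) with k | k
    · simpa using (k x).1 ((hs x).2 (.inl rfl))
    · exact (((hs x').1 ((k x').2 (.inl rfl))).elim id id).symm
  subst hx
  refine ⟨rfl, ?_⟩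
  have key : ∀ u u' : M, (∀ z, IsUPair z x x ∨ IsUPair z x u → IsUPair z x x ∨ IsUPair z x u') →
      u = x ∨ u = u' := by
    intro u u' H
    obtain ⟨r, hr⟩ := exists_isUPair x u
    have hu := (hr u).2 (.inr rfl)
    rcases H r (.inr hr) with k | k
    · exact .inl (((k u).1 hu).elim id id)
    · exact (k u).1 hu
  rcases key y y' fun z hz => (h' z).1 ((h z).2 hz) with k | k
  · rcases key y' y fun z hz => (h z).1 ((h' z).2 hz) with k' | k'
    · rw [k, k']
    · exact k'.symm
  · exact k

/-- A definable relation between the elements of two sets is a set. -/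
theorem exists_rel (Q : M → M → Prop) (a b : M)
    [Dfb (fun v => Q (v 0) (v 1))] :
    ∃ r : M, (∀ p : M, p ∈ₘ r → ∃ x y : M, x ∈ₘ a ∧ y ∈ₘ b ∧ IsOPair p x y) ∧
      ∀ x y : M, App r x y ↔ x ∈ₘ a ∧ y ∈ₘ b ∧ Q x y := by
  have := Dfb.subst₂ Q
  obtain ⟨u, hu⟩ := exists_union a b
  obtain ⟨p₁, hp₁⟩ := ModelsZF.powerset u
  obtain ⟨p₂, hp₂⟩ := ModelsZF.powerset p₁
  obtain ⟨r, hr⟩ := exists_sep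
    (fun p => ∃ x, ∃ y, x ∈ₘ a ∧ y ∈ₘ b ∧ IsOPair p x y ∧ Q x y) p₂
  refine ⟨r, fun p hp => ?_, fun x y => ⟨?_, ?_⟩⟩
  · obtain ⟨-, x, y, hx, hy, hp, -⟩ := (hr p).1 hp
    exact ⟨x, y, hx, hy, hp⟩
  · rintro ⟨p, hp, hpr⟩
    obtain ⟨-, x', y', hx, hy, hp', hQ⟩ := (hr p).1 hpr
    obtain ⟨rfl, rfl⟩ := hp.inj hp'
    exact ⟨hx, hy, hQ⟩
  · rintro ⟨hx, hy, hQ⟩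
    obtain ⟨p, hp⟩ := exists_isOPair x y
    refine ⟨p, hp, (hr p).2 ⟨(hp₂ p).2 fun z hz => (hp₁ z).2 fun t ht => (hu t).2 ?_,
      x, y, hx, hy, hp, hQ⟩⟩
    rcases (hp z).1 hz with k | k <;> rcases (k t).1 ht with rfl | rfl <;> simp [hx, hy]

end ZFModel

/-! ### Kuratowski finiteness and finite classes. -/

namespace ZFModel

variable {M : Type*} [setLang.Structure M]

/-- `a` is finite in the sense of Kuratowski. -/
def KFinite (a : M) : Prop :=
  ∀ C : M, (∀ e : M, (∀ z : M, ¬ z ∈ₘ e) → e ∈ₘ C) →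
    (∀ x u y : M, x ∈ₘ C → u ∈ₘ a → (∀ z : M, z ∈ₘ y ↔ z ∈ₘ x ∨ z = u) → y ∈ₘ C) → a ∈ₘ C

instance Dfb.kFinite (f : (ℕ → M) → M) [IsAtomicTerm f] : Dfb (fun v => KFinite (f v)) := by
  unfold KFinite; infer_instance

/-- The class defined by `Q` is contained in a finite set. -/
abbrev FinClass (Q : M → Prop) : Prop := ∃ s : M, KFinite s ∧ ∀ z : M, Q z → z ∈ₘ s

theorem FinClass.mono {P Q : M → Prop} (hQ : FinClass Q) (h : ∀ z, P z → Q z) : FinClass P := by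
  obtain ⟨s, hs, hQs⟩ := hQ
  exact ⟨s, hs, fun z hz => hQs z (h z hz)⟩

theorem KFinite.empty {e : M} (he : ∀ z : M, ¬ z ∈ₘ e) : KFinite e := fun _ h _ => h e he

theorem KFinite.insert {x u y : M} (hx : KFinite x) (hy : ∀ z : M, z ∈ₘ y ↔ z ∈ₘ x ∨ z = u) :
    KFinite y := fun C h₀ h₁ =>
  h₁ x u y (hx C h₀ fun x' u' y' hx' hu' => h₁ x' u' y' hx' ((hy u').2 (.inl hu')))
    ((hy u).2 (.inr rfl)) hy

variable [ModelsZF M]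

theorem KFinite.induction {a : M} (ha : KFinite a) (P : M → Prop) [Dfb (fun v => P (v 0))]
    (empty : ∀ e : M, (∀ z : M, ¬ z ∈ₘ e) → P e)
    (insert : ∀ x u y : M, P x → u ∈ₘ a → (∀ z : M, z ∈ₘ y ↔ z ∈ₘ x ∨ z = u) → P y) : P a := by
  obtain ⟨p, hp⟩ := ModelsZF.powerset a
  obtain ⟨C, hC⟩ := exists_sep P p
  refine ((hC a).1 (ha C (fun e he => (hC e).2 ⟨(hp e).2 fun z hz => (he z hz).elim, empty e he⟩)
    fun x u y hx hu hy => (hC y).2 ⟨(hp y).2 fun z hz => ?_, ?_⟩)).2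
  · rcases (hy z).1 hz with h | rfl
    · exact (hp x).1 ((hC x).1 hx).1 z h
    · exact hu
  · exact insert x u y ((hC x).1 hx).2 hu hy

theorem KFinite.union {s t : M} (hs : KFinite s) (ht : KFinite t) :
    ∃ r : M, KFinite r ∧ ∀ z, z ∈ₘ s ∨ z ∈ₘ t → z ∈ₘ r := by
  refine hs.induction (fun s => ∃ r : M, KFinite r ∧ ∀ z, z ∈ₘ s ∨ z ∈ₘ t → z ∈ₘ r) ?_ ?_
  · exact fun e he => ⟨t, ht, fun z hz => hz.resolve_left (he z)⟩
  · rintro x u y ⟨r, hr, hxr⟩ - hy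
    obtain ⟨r', hr'⟩ := exists_insert r u
    refine ⟨r', hr.insert hr', fun z hz => (hr' z).2 ?_⟩
    rw [hy] at hz
    rcases hz with (h | h) | h
    · exact .inl (hxr z (.inl h))
    · exact .inr h
    · exact .inl (hxr z (.inr h))

theorem FinClass.or {P Q : M → Prop} (hP : FinClass P) (hQ : FinClass Q) :
    FinClass (fun z => P z ∨ Q z) := by
  obtain ⟨s, hs, hPs⟩ := hP
  obtain ⟨t, ht, hQt⟩ := hQ
  obtain ⟨r, hr, hst⟩ := hs.union ht
  exact ⟨r, hr, fun z hz => hst z (hz.imp (hPs z) (hQt z))⟩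

theorem FinClass.of_eq (a : M) : FinClass (fun z => z = a) := by
  obtain ⟨e, he⟩ := exists_empty (M := M)
  obtain ⟨s, hs⟩ := exists_insert e a
  exact ⟨s, (KFinite.empty he).insert hs, fun z hz => (hs z).2 (.inr hz)⟩

theorem FinClass.of_false {Q : M → Prop} (h : ∀ z, ¬ Q z) : FinClass Q := by
  obtain ⟨e, he⟩ := exists_empty (M := M)
  exact ⟨e, KFinite.empty he, fun z hz => (h z hz).elim⟩

/-- Induction on a finite set bounding `P` needs only one bounding set for `Q u` at each step, so no
choice is involved. -/
theorem FinClass.biUnion {P : M → Prop} (hP : FinClass P) (Q : M → M → Prop)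
    [Dfb (fun v => Q (v 0) (v 1))]
    [Dfb (fun v => P (v 0))]
    (h : ∀ y, P y → FinClass (Q y)) : FinClass (fun z => ∃ y, P y ∧ Q y z) := by
  have := Dfb.subst₂ Q
  obtain ⟨s, hs, hPs⟩ := hP
  obtain ⟨s', hs'⟩ := exists_sep P s
  have key : FinClass (fun z => ∃ y, y ∈ₘ s ∧ y ∈ₘ s' ∧ Q y z) := by
    refine hs.induction (fun x => FinClass (fun z => ∃ y, y ∈ₘ x ∧ y ∈ₘ s' ∧ Q y z)) ?_ ?_
    · exact fun e he => .of_false fun z ⟨y, hy, _⟩ => he y hy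
    · intro x u y hx hu hy
      have hQ : FinClass (fun z => u ∈ₘ s' ∧ Q u z) := by
        by_cases hu' : u ∈ₘ s'
        · exact (h u ((hs' u).1 hu').2).mono fun z hz => hz.2
        · exact .of_false fun z hz => hu' hz.1
      refine (hx.or hQ).mono ?_
      rintro z ⟨w, hw, hw', hz⟩
      rcases (hy w).1 hw with k | rfl
      · exact .inl ⟨w, k, hw', hz⟩
      · exact .inr ⟨hw', hz⟩
  exact key.mono fun z ⟨y, hy, hz⟩ => ⟨y, hPs y hy, (hs' y).2 ⟨hPs y hy, hy⟩, hz⟩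

theorem FinClass.functional {P : M → Prop} (hP : FinClass P) (Q : M → M → Prop)
    [Dfb (fun v => Q (v 0) (v 1))]
    [Dfb (fun v => P (v 0))]
    (h : ∀ y z z', P y → Q y z → Q y z' → z = z') : FinClass (fun z => ∃ y, P y ∧ Q y z) := by
  refine hP.biUnion Q fun y hy => ?_
  by_cases hz : ∃ z, Q y z
  · obtain ⟨z, hz⟩ := hz
    exact (FinClass.of_eq z).mono fun z' hz' => h y z' z hy hz' hz
  · exact .of_false fun z h => hz ⟨z, h⟩

/-! ### The natural numbers of the model. -/

theorem exists_isOmega : ∃ w : M, IsOmega w := by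
  obtain ⟨a, ha⟩ := ModelsZF.infinity (M := M)
  obtain ⟨w, hw⟩ := exists_sep (fun x => ∀ v, IsInductive v → x ∈ₘ v) a
  refine ⟨w, ⟨?_, fun x hx => ?_⟩, fun v hv x hx => ((hw x).1 hx).2 v hv⟩
  · obtain ⟨e, hea, he⟩ := ha.1
    refine ⟨e, (hw e).2 ⟨hea, fun v hv => ?_⟩, he⟩
    obtain ⟨e', hev, he'⟩ := hv.1
    rwa [ext (x := e) (y := e') fun z => iff_of_false (he z) (he' z)]
  · obtain ⟨hxa, hx⟩ := (hw x).1 hx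
    obtain ⟨s, hsa, hs⟩ := ha.2 x hxa
    refine ⟨s, (hw s).2 ⟨hsa, fun v hv => ?_⟩, hs⟩
    obtain ⟨s', hsv, hs'⟩ := hv.2 x (hx v hv)
    rwa [ext (x := s) (y := s') fun z => (hs z).trans (hs' z).symm]

theorem IsSucc.unique {s t x : M} (hs : IsSucc s x) (ht : IsSucc t x) : s = t :=
  ext fun z => (hs z).trans (ht z).symm

theorem IsSucc.inj {s x y : M} (hx : IsSucc s x) (hy : IsSucc s y) : x = y := by
  rcases (hy x).1 ((hx x).2 (.inr rfl)) with h | h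
  · rcases (hx y).1 ((hy y).2 (.inr rfl)) with h' | h'
    · exact (mem_asymm h h').elim
    · exact h'.symm
  · exact h

namespace IsOmega

variable {ω : M} (hω : IsOmega ω)
include hω

theorem succ_mem {n s : M} (hn : n ∈ₘ ω) (hs : IsSucc s n) : s ∈ₘ ω := by
  obtain ⟨t, ht, htn⟩ := hω.1.2 n hn
  rwa [hs.unique htn]

theorem induction (P : M → Prop) [Dfb (fun v => P (v 0))] (zero : ∀ e : M, (∀ z, ¬ z ∈ₘ e) → P e)
    (succ : ∀ n s : M, n ∈ₘ ω → P n → IsSucc s n → P s) {n : M} (hn : n ∈ₘ ω) : P n := by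
  obtain ⟨w, hw⟩ := exists_sep P ω
  refine ((hw n).1 (hω.2 w ⟨?_, fun x hx => ?_⟩ n hn)).2
  · obtain ⟨e, heω, he⟩ := hω.1.1
    exact ⟨e, (hw e).2 ⟨heω, zero e he⟩, he⟩
  · obtain ⟨hxω, hx⟩ := (hw x).1 hx
    obtain ⟨s, hsω, hs⟩ := hω.1.2 x hxω
    exact ⟨s, (hw s).2 ⟨hsω, succ x s hxω hx hs⟩, hs⟩

theorem mem_of_mem {n m : M} (hn : n ∈ₘ ω) (hm : m ∈ₘ n) : m ∈ₘ ω := by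
  refine hω.induction (fun n => ∀ m, m ∈ₘ n → m ∈ₘ ω) ?_ ?_ hn m hm
  · exact fun e he m hm => (he m hm).elim
  · intro n s hn ih hs m hm
    rcases (hs m).1 hm with h | rfl
    · exact ih m h
    · exact hn

theorem mem_trans {n m k : M} (hn : n ∈ₘ ω) (hm : m ∈ₘ n) (hk : k ∈ₘ m) : k ∈ₘ n := by
  refine hω.induction (fun n => ∀ m, m ∈ₘ n → ∀ k, k ∈ₘ m → k ∈ₘ n) ?_ ?_ hn m hm k hk
  · exact fun e he m hm => (he m hm).elim
  · intro n s hn ih hs m hm k hk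
    rcases (hs m).1 hm with h | rfl
    · exact (hs k).2 (.inl (ih m h k hk))
    · exact (hs k).2 (.inl hk)

theorem trichotomy {n m : M} (hn : n ∈ₘ ω) (hm : m ∈ₘ ω) : m ∈ₘ n ∨ m = n ∨ n ∈ₘ m := by
  refine hω.induction (fun n => ∀ m, m ∈ₘ ω → m ∈ₘ n ∨ m = n ∨ n ∈ₘ m) ?_ ?_ hn m hm
  · intro e he m hm
    refine .inr (hω.induction (fun m => m = e ∨ e ∈ₘ m) ?_ ?_ hm)
    · exact fun e' he' => .inl (ext fun z => iff_of_false (he' z) (he z))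
    · rintro n s - (rfl | h) hs
      · exact .inr ((hs n).2 (.inr rfl))
      · exact .inr ((hs e).2 (.inl h))
  · intro n s hn ih hs m hm
    rcases ih m hm with h | rfl | h
    · exact .inl ((hs m).2 (.inl h))
    · exact .inl ((hs m).2 (.inr rfl))
    · refine .inr (hω.induction (fun m => n ∈ₘ m → m = s ∨ s ∈ₘ m) ?_ ?_ hm h)
      · exact fun e he h => (he n h).elim
      · intro m t _ ih ht h
        rcases (ht n).1 h with h | rfl
        · rcases ih h with rfl | h
          · exact .inr ((ht m).2 (.inr rfl))
          · exact .inr ((ht s).2 (.inl h))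
        · exact .inl (ht.unique hs)

theorem kFinite {n : M} (hn : n ∈ₘ ω) : KFinite n :=
  hω.induction KFinite (fun _ he => .empty he) (fun _ _ _ h hs => h.insert hs) hn

/-- A finite class of natural numbers does not contain all of them. -/
theorem exists_notMem {Q : M → Prop} (hQ : FinClass Q) : ∃ n, n ∈ₘ ω ∧ ¬ Q n := by
  obtain ⟨s, hs, hQs⟩ := hQ
  have key : ∃ n, n ∈ₘ ω ∧ ∀ m, m ∈ₘ s → m ∈ₘ ω → m ∈ₘ n := by
    refine hs.induction (fun s => ∃ n, n ∈ₘ ω ∧ ∀ m, m ∈ₘ s → m ∈ₘ ω → m ∈ₘ n) ?_ ?_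
    · obtain ⟨e, heω, -⟩ := hω.1.1
      exact fun e' he' => ⟨e, heω, fun m hm => (he' m hm).elim⟩
    · rintro x u y ⟨n, hn, hx⟩ - hy
      -- If the new element is a natural number not below the old bound, its successor is the new
      -- bound.
      by_cases hu : u ∈ₘ ω ∧ ¬ u ∈ₘ n
      · obtain ⟨s, hsω, hs⟩ := hω.1.2 u hu.1
        refine ⟨s, hsω, fun m hm hmω => (hs m).2 ?_⟩
        rcases (hy m).1 hm with h | h
        · rcases hω.trichotomy hn hu.1 with k | rfl | k
          · exact (hu.2 k).elim
          · exact .inl (hx m h hmω)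
          · exact .inl (hω.mem_trans hu.1 k (hx m h hmω))
        · exact .inr h
      · refine ⟨n, hn, fun m hm hmω => ?_⟩
        rcases (hy m).1 hm with h | rfl
        · exact hx m h hmω
        · exact not_not.1 fun h => hu ⟨hmω, h⟩
  obtain ⟨n, hn, h⟩ := key
  exact ⟨n, hn, fun hq => mem_irrefl n (h n (hQs n hq) hn)⟩

/-- The set is the image of a natural number under the inverse of an injection. -/
theorem finClass_of_cardLt {a : M} (ha : CardLt a ω) : FinClass (fun z => z ∈ₘ a) := by
  obtain ⟨n, hn, f, ⟨⟨hf, hinj⟩, -⟩⟩ := ha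
  have h : FinClass (fun z => z ∈ₘ n) := ⟨n, hω.kFinite hn, fun _ => id⟩
  refine (h.functional (fun y z => App f z y) fun y z z' _ => hinj z z' y).mono fun z hz => ?_
  obtain ⟨y, hy, -⟩ := hf.2 z hz
  obtain ⟨p, hp, hpf⟩ := hy
  obtain ⟨x, y', -, hy', hp'⟩ := hf.1 p hpf
  obtain ⟨-, rfl⟩ := hp.inj hp'
  exact ⟨y, hy', p, hp, hpf⟩

end IsOmega

end ZFModel

/-! ### Greedy colourings along well-founded relations. -/

namespace ZFModel

variable {M : Type*} [setLang.Structure M]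

/-- `g` is a partial colouring of `a` by natural numbers whose domain is closed under
`R`-predecessors, each value being the least one not taken by an `R`-predecessor. -/
def IsGreedyPartial (R : M → M → Prop) (a ω g : M) : Prop :=
  (∀ ξ n n' : M, App g ξ n → App g ξ n' → n = n') ∧
  ∀ ξ n : M, App g ξ n → ξ ∈ₘ a ∧ n ∈ₘ ω ∧
    (∀ η : M, η ∈ₘ a → R η ξ → ∃ k : M, App g η k) ∧
    (∀ m : M, m ∈ₘ n → ∃ η : M, η ∈ₘ a ∧ R η ξ ∧ App g η m) ∧
    ∀ η : M, η ∈ₘ a → R η ξ → ¬ App g η n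

instance Dfb.isGreedyPartial (R : M → M → Prop) [Dfb (fun v => R (v 0) (v 1))] (a ω : M)
    (f : (ℕ → M) → M) [IsAtomicTerm f] : Dfb (fun v => IsGreedyPartial R a ω (f v)) := by
  have := Dfb.subst₂ R
  unfold IsGreedyPartial; infer_instance

variable [ModelsZF M]

theorem IsFun.mem {f a b x y : M} (hf : IsFun f a b) (h : App f x y) : x ∈ₘ a ∧ y ∈ₘ b := by
  obtain ⟨p, hp, hpf⟩ := h
  obtain ⟨x', y', hx, hy, hp'⟩ := hf.1 p hpf
  obtain ⟨rfl, rfl⟩ := hp.inj hp'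
  exact ⟨hx, hy⟩

theorem IsFun.unique {f a b x y y' : M} (hf : IsFun f a b) (h : App f x y) (h' : App f x y') :
    y = y' :=
  (hf.2 x (hf.mem h).1).unique h h'

/-- At an `R`-minimal disagreement the predecessors agree. The smaller of the two values is taken by
a predecessor under one colouring, hence under the other, where it must be free. -/
theorem IsGreedyPartial.agree {ω : M} (hω : IsOmega ω) {a : M} (R : M → M → Prop)
    (wf : ∀ X x : M, Incl X a → x ∈ₘ X → ∃ y : M, y ∈ₘ X ∧ ∀ z : M, z ∈ₘ X → ¬ R z y)
    {g g' : M} (hg : IsGreedyPartial R a ω g)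
    (hg' : IsGreedyPartial R a ω g') {ξ n n' : M} (h : App g ξ n) (h' : App g' ξ n') : n = n' := by
  by_contra hne
  obtain ⟨X, hX⟩ := exists_sep (fun ξ => ∃ n n', App g ξ n ∧ App g' ξ n' ∧ ¬ n = n') a
  obtain ⟨ξ₀, hξ₀, hmin⟩ := wf X ξ (fun z hz => ((hX z).1 hz).1)
    ((hX ξ).2 ⟨(hg.2 ξ n h).1, n, n', h, h', hne⟩)
  obtain ⟨-, k, k', hk, hk', hkk⟩ := (hX ξ₀).1 hξ₀
  obtain ⟨-, hkω, hdom, hlow, hav⟩ := hg.2 _ _ hk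
  obtain ⟨-, hkω', hdom', hlow', hav'⟩ := hg'.2 _ _ hk'
  have below : ∀ η m m', η ∈ₘ a → R η ξ₀ → App g η m → App g' η m' → m = m' := by
    intro η m m' hη hR hm hm'
    by_contra hmm
    exact hmin η ((hX η).2 ⟨hη, m, m', hm, hm', hmm⟩) hR
  rcases hω.trichotomy hkω hkω' with h | h | h
  · obtain ⟨η, hη, hR, hm⟩ := hlow _ h
    obtain ⟨m', hm'⟩ := hdom' η hη hR
    obtain rfl := below η _ _ hη hR hm hm'
    exact hav' η hη hR hm'
  · exact hkk h.symm
  · obtain ⟨η, hη, hR, hm⟩ := hlow' _ h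
    obtain ⟨m', hm'⟩ := hdom η hη hR
    obtain rfl := below η _ _ hη hR hm' hm
    exact hav η hη hR hm'

/-- The greedy colouring along a well-founded relation whose sets of predecessors are finite. -/
theorem exists_greedy {ω : M} (hω : IsOmega ω) {a : M} (R : M → M → Prop)
    [Dfb (fun v => R (v 0) (v 1))]
    (wf : ∀ X x : M, Incl X a → x ∈ₘ X → ∃ y : M, y ∈ₘ X ∧ ∀ z : M, z ∈ₘ X → ¬ R z y)
    (fin : ∀ ξ : M, ξ ∈ₘ a → FinClass (fun η => η ∈ₘ a ∧ R η ξ)) :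
    ∃ c : M, IsFun c a ω ∧
      (∀ ξ n m : M, App c ξ n → m ∈ₘ n → ∃ η : M, η ∈ₘ a ∧ R η ξ ∧ App c η m) ∧
      ∀ ξ η n : M, η ∈ₘ a → R η ξ → App c ξ n → ¬ App c η n := by
  have := Dfb.subst₂ R
  -- `c` is the union of all partial greedy colourings.
  obtain ⟨c, hc, hcQ⟩ := exists_rel (fun ξ n => ∃ g, IsGreedyPartial R a ω g ∧ App g ξ n) a ω
  have hgc : ∀ g, IsGreedyPartial R a ω g → ∀ ξ n, App g ξ n → App c ξ n := fun g hg ξ n h =>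
    (hcQ ξ n).2 ⟨(hg.2 ξ n h).1, (hg.2 ξ n h).2.1, g, hg, h⟩
  have hpart : IsGreedyPartial R a ω c := by
    refine ⟨fun ξ n n' h h' => ?_, fun ξ n h => ?_⟩
    · obtain ⟨-, -, g, hg, hn⟩ := (hcQ ξ n).1 h
      obtain ⟨-, -, g', hg', hn'⟩ := (hcQ ξ n').1 h'
      exact hg.agree hω R wf hg' hn hn'
    · obtain ⟨hξ, hnω, g, hg, hn⟩ := (hcQ ξ n).1 h
      obtain ⟨-, -, hdom, hlow, hav⟩ := hg.2 ξ n hn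
      refine ⟨hξ, hnω, fun η hη hR => ?_, fun m hm => ?_, fun η hη hR h' => ?_⟩
      · obtain ⟨k, hk⟩ := hdom η hη hR
        exact ⟨k, hgc g hg _ _ hk⟩
      · obtain ⟨η, hη, hR, hm⟩ := hlow m hm
        exact ⟨η, hη, hR, hgc g hg _ _ hm⟩
      · obtain ⟨-, -, g', hg', hn'⟩ := (hcQ η n).1 h'
        obtain ⟨k, hk⟩ := hdom η hη hR
        obtain rfl := hg.agree hω R wf hg' hk hn'
        exact hav η hη hR hk
  have total : ∀ ξ, ξ ∈ₘ a → ∃ n, App c ξ n := by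
    intro ξ hξ
    by_contra hno
    obtain ⟨X, hX⟩ := exists_sep (fun ξ => ¬ ∃ n, App c ξ n) a
    obtain ⟨ξ₀, hξ₀, hmin⟩ := wf X ξ (fun z hz => ((hX z).1 hz).1) ((hX ξ).2 ⟨hξ, hno⟩)
    obtain ⟨hξ₀a, hξ₀c⟩ := (hX ξ₀).1 hξ₀
    have hdom : ∀ η, η ∈ₘ a → R η ξ₀ → ∃ k, App c η k := by
      intro η hη hR
      by_contra h
      exact hmin η ((hX η).2 ⟨hη, h⟩) hR
    have hfin : FinClass (fun n => ∃ η, (η ∈ₘ a ∧ R η ξ₀) ∧ App c η n) :=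
      (fin ξ₀ hξ₀a).functional (fun η n => App c η n) fun η n n' _ => hpart.1 η n n'
    obtain ⟨k, hkω, hk⟩ := hω.exists_notMem hfin
    obtain ⟨n, hnω, hn, hnmin⟩ := exists_minimal
      (fun n => ¬ ∃ η, (η ∈ₘ a ∧ R η ξ₀) ∧ App c η n) hkω hk
    -- Colouring the minimal uncoloured point `ξ₀` with the least free colour `n` extends `c`,
    -- although `c` already contains every partial greedy colouring.
    obtain ⟨g, hg, hgQ⟩ := exists_rel (fun ξ m => App c ξ m ∨ ξ = ξ₀ ∧ m = n) a ω
    have hcg : ∀ ξ m, App c ξ m → App g ξ m := fun ξ m h =>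
      (hgQ ξ m).2 ⟨(hpart.2 ξ m h).1, (hpart.2 ξ m h).2.1, .inl h⟩
    have hgc' : ∀ ξ m, App g ξ m → ¬ ξ = ξ₀ → App c ξ m := fun ξ m h hne =>
      ((hgQ ξ m).1 h).2.2.resolve_right fun h' => hne h'.1
    have irrefl : ¬ R ξ₀ ξ₀ := hmin ξ₀ hξ₀
    have hpg : IsGreedyPartial R a ω g := by
      refine ⟨fun ξ m m' h h' => ?_, fun ξ m h => ?_⟩
      · rcases ((hgQ ξ m).1 h).2.2 with h | ⟨rfl, rfl⟩
        · rcases ((hgQ ξ m').1 h').2.2 with h' | ⟨rfl, rfl⟩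
          · exact hpart.1 ξ m m' h h'
          · exact (hξ₀c ⟨m, h⟩).elim
        · rcases ((hgQ _ m').1 h').2.2 with h' | ⟨-, rfl⟩
          · exact (hξ₀c ⟨m', h'⟩).elim
          · rfl
      · rcases ((hgQ ξ m).1 h).2.2 with h | ⟨rfl, rfl⟩
        · obtain ⟨h₁, h₂, h₃, h₄, h₅⟩ := hpart.2 ξ m h
          refine ⟨h₁, h₂, fun η hη hR => ?_, fun k hk => ?_, fun η hη hR h' => ?_⟩
          · obtain ⟨k, hk⟩ := h₃ η hη hR
            exact ⟨k, hcg _ _ hk⟩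
          · obtain ⟨η, hη, hR, hm⟩ := h₄ k hk
            exact ⟨η, hη, hR, hcg _ _ hm⟩
          · rcases ((hgQ η m).1 h').2.2 with h' | ⟨rfl, -⟩
            · exact h₅ η hη hR h'
            · exact hξ₀c (h₃ _ hη hR)
        · refine ⟨hξ₀a, hnω, fun η hη hR => ?_, fun k hk => ?_, fun η hη hR h' => ?_⟩
          · obtain ⟨k, hk⟩ := hdom η hη hR
            exact ⟨k, hcg _ _ hk⟩
          · by_contra hno
            refine hnmin k (hω.mem_of_mem hnω hk) (fun ⟨η, hη, hk'⟩ => hno ?_) hk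
            exact ⟨η, hη.1, hη.2, hcg _ _ hk'⟩
          · refine hn ⟨η, ⟨hη, hR⟩, hgc' η _ h' ?_⟩
            rintro rfl
            exact irrefl hR
    exact hξ₀c ⟨n, hgc g hpg ξ₀ n ((hgQ ξ₀ n).2 ⟨hξ₀a, hnω, .inr ⟨rfl, rfl⟩⟩)⟩
  refine ⟨c, ⟨hc, fun ξ hξ => ?_⟩, fun ξ n m h hm => (hpart.2 ξ n h).2.2.2.1 m hm,
    fun ξ η n hη hR h => (hpart.2 ξ n h).2.2.2.2 η hη hR⟩
  obtain ⟨n, hn⟩ := total ξ hξ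
  exact ⟨n, hn, fun m hm => hpart.1 ξ m n hm hn⟩

/-- A map to `ω` whose range is an initial segment and which is injective on an infinite set is
onto. -/
theorem IsFun.onto_of_initial {ω a c : M} (hω : IsOmega ω) (hc : IsFun c a ω)
    (low : ∀ ξ n m : M, App c ξ n → m ∈ₘ n → ∃ η : M, App c η m)
    {A : M} (hAa : Incl A a) (hA : ¬ FinClass (fun ξ => ξ ∈ₘ A))
    (inj : ∀ ξ ξ' n : M, ξ ∈ₘ A → ξ' ∈ₘ A → App c ξ n → App c ξ' n → ξ = ξ') {k : M} (hk : k ∈ₘ ω) :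
    ∃ ξ : M, App c ξ k := by
  by_contra hno
  have hk' : FinClass (fun n => n ∈ₘ k) := ⟨k, hω.kFinite hk, fun _ => id⟩
  refine hA ((hk'.functional (fun n ξ => ξ ∈ₘ A ∧ App c ξ n)
    fun n ξ ξ' _ h h' => inj ξ ξ' n h.1 h'.1 h.2 h'.2).mono fun ξ hξ => ?_)
  obtain ⟨n, hn, -⟩ := hc.2 ξ (hAa ξ hξ)
  refine ⟨n, ?_, hξ, hn⟩
  -- A value above the missed `k` would put `k` in the range, so all values lie below `k` and `A`
  -- would be finite.
  rcases hω.trichotomy hk (hc.mem hn).2 with h | h | h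
  · exact h
  · exact (hno ⟨ξ, h ▸ hn⟩).elim
  · exact (hno (low ξ n k hn h)).elim

/-- A set with a well-order all of whose initial segments are finite injects into `ω`, and is
equinumerous with `ω` if it is infinite. -/
theorem exists_isInj_of_finite_segments {ω : M} (hω : IsOmega ω) {a : M} (R : M → M → Prop)
    [Dfb (fun v => R (v 0) (v 1))]
    (wf : ∀ X x : M, Incl X a → x ∈ₘ X → ∃ y : M, y ∈ₘ X ∧ ∀ z : M, z ∈ₘ X → ¬ R z y)
    (fin : ∀ ξ : M, ξ ∈ₘ a → FinClass (fun η => η ∈ₘ a ∧ R η ξ))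
    (total : ∀ ξ η : M, ξ ∈ₘ a → η ∈ₘ a → R ξ η ∨ ξ = η ∨ R η ξ) :
    ∃ c : M, IsInj c a ω ∧ (¬ FinClass (fun ξ => ξ ∈ₘ a) → IsBij c a ω) := by
  obtain ⟨c, hc, low, av⟩ := exists_greedy hω R wf fin
  have inj : IsInj c a ω := by
    refine ⟨hc, fun ξ η n h h' => ?_⟩
    rcases total ξ η (hc.mem h).1 (hc.mem h').1 with hR | hR | hR
    · exact (av η ξ n (hc.mem h).1 hR h' h).elim
    · exact hR
    · exact (av ξ η n (hc.mem h').1 hR h h').elim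
  refine ⟨c, inj, fun ha => ⟨inj, fun n hn => ?_⟩⟩
  exact hc.onto_of_initial hω (fun ξ n m h hm => (low ξ n m h hm).imp fun _ h => h.2.2)
    (fun _ => id) ha (fun ξ ξ' n _ _ => inj.2 ξ ξ' n) hn

theorem exists_mem_minimal {X a : M} (x : M) (_ : Incl X a) (hx : x ∈ₘ X) :
    ∃ y : M, y ∈ₘ X ∧ ∀ z : M, z ∈ₘ X → ¬ z ∈ₘ y :=
  ModelsZF.foundation X ⟨x, hx⟩

theorem exists_isInj_of_finite_mem_segments {ω : M} (hω : IsOmega ω) {κ a : M} (hκ : IsOrdinal κ)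
    (ha : Incl a κ) (fin : ∀ ξ : M, ξ ∈ₘ a → FinClass (fun η => η ∈ₘ a ∧ η ∈ₘ ξ)) :
    ∃ c : M, IsInj c a ω ∧ (¬ FinClass (fun ξ => ξ ∈ₘ a) → IsBij c a ω) :=
  exists_isInj_of_finite_segments hω (fun η ξ => η ∈ₘ ξ) (fun _ => exists_mem_minimal) fin
    fun ξ η hξ hη => hκ.2 ξ η (ha ξ hξ) (ha η hη)

/-- An infinite set of ordinals has an infinite subset whose initial segments are finite. -/
theorem exists_infinite_finite_mem_segments {X : M} (hX : ¬ FinClass (fun ξ => ξ ∈ₘ X)) :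
    ∃ A : M, Incl A X ∧ ¬ FinClass (fun ξ => ξ ∈ₘ A) ∧
      ∀ ξ : M, ξ ∈ₘ A → FinClass (fun η => η ∈ₘ X ∧ η ∈ₘ ξ) := by
  obtain ⟨A, hA⟩ := exists_sep (fun ξ => FinClass (fun η => η ∈ₘ X ∧ η ∈ₘ ξ)) X
  refine ⟨A, fun ξ hξ => ((hA ξ).1 hξ).1, fun hfin => hX ?_, fun ξ hξ => ((hA ξ).1 hξ).2⟩
  refine hfin.mono fun ξ hξ => ?_
  by_contra hξA
  -- All predecessors in `X` of a minimal element outside `A` lie in `A`; if `A` is finite, that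
  -- element belongs to `A` after all.
  obtain ⟨ξ₀, h₀, h₀A, hmin⟩ := exists_minimal (fun ξ => ¬ ξ ∈ₘ A) hξ hξA
  refine h₀A ((hA ξ₀).2 ⟨h₀, hfin.mono fun η hη => ?_⟩)
  by_contra h
  exact hmin η hη.1 h hη.2

theorem not_finClass_of_not_isCountable {ω : M} (hω : IsOmega ω) {κ : M} (hκ : IsOrdinal κ)
    (h : ¬ IsCountable κ) : ¬ FinClass (fun ξ => ξ ∈ₘ κ) := by
  intro hfin
  obtain ⟨c, hc, -⟩ := exists_isInj_of_finite_mem_segments hω hκ (fun _ => id)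
    fun ξ _ => hfin.mono fun η hη => hη.1
  exact h ⟨ω, c, hω, hc⟩

end ZFModel

/-! ### Reachability ranks and colouring graphs of finite out-degree. -/

namespace ZFModel

variable {M : Type*} [setLang.Structure M]

/-- `ξ` can be reached from `α` along at most `n` edges of `E`. -/
def Reach (E : M → M → Prop) (ω α n ξ : M) : Prop :=
  ∀ X : M, (∀ e : M, (∀ z : M, ¬ z ∈ₘ e) → App X e α) →
    (∀ m s ξ η : M, m ∈ₘ ω → IsSucc s m → App X m ξ → η = ξ ∨ E η ξ → App X s η) → App X n ξ

instance Dfb.reach (E : M → M → Prop) [Dfb (fun v => E (v 0) (v 1))] (ω : M)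
    (f g h : (ℕ → M) → M) [IsAtomicTerm f] [IsAtomicTerm g] [IsAtomicTerm h] :
    Dfb (fun v => Reach E ω (f v) (g v) (h v)) := by
  have := Dfb.subst₂ E
  unfold Reach; infer_instance

/-- `α` is the least element of `κ` from which `ξ` can be reached, and `n` is the distance. -/
def IsRank (E : M → M → Prop) (κ ω ξ α n : M) : Prop :=
  α ∈ₘ κ ∧ n ∈ₘ ω ∧ Reach E ω α n ξ ∧
    (∀ β : M, β ∈ₘ α → ∀ m : M, m ∈ₘ ω → ¬ Reach E ω β m ξ) ∧
    ∀ m : M, m ∈ₘ n → ¬ Reach E ω α m ξ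

instance Dfb.isRank (E : M → M → Prop) [Dfb (fun v => E (v 0) (v 1))] (κ ω : M)
    (f g h : (ℕ → M) → M) [IsAtomicTerm f] [IsAtomicTerm g] [IsAtomicTerm h] :
    Dfb (fun v => IsRank E κ ω (f v) (g v) (h v)) := by
  unfold IsRank; infer_instance

/-- `η` precedes its neighbour `ξ` in the lexicographic order by rank. -/
def Precedes (E : M → M → Prop) (κ ω η ξ : M) : Prop :=
  (E η ξ ∨ E ξ η) ∧ ∃ α n β m : M, IsRank E κ ω η α n ∧ IsRank E κ ω ξ β m ∧
    (α ∈ₘ β ∨ α = β ∧ (n ∈ₘ m ∨ n = m ∧ η ∈ₘ ξ))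

instance Dfb.precedes (E : M → M → Prop) [Dfb (fun v => E (v 0) (v 1))] (κ ω : M)
    (f g : (ℕ → M) → M) [IsAtomicTerm f] [IsAtomicTerm g] :
    Dfb (fun v => Precedes E κ ω (f v) (g v)) := by
  have := Dfb.subst₂ E
  unfold Precedes; infer_instance

theorem IsOrdinal.mem_of_mem {κ α β : M} (hκ : IsOrdinal κ) (hα : α ∈ₘ κ) (hβ : β ∈ₘ α) : β ∈ₘ κ :=
  hκ.1 α hα β hβ

namespace Reach

variable {E : M → M → Prop} {ω α : M}

theorem zero {e : M} (he : ∀ z : M, ¬ z ∈ₘ e) : Reach E ω α e α := fun _ h₀ _ => h₀ e he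

theorem succ {m s ξ η : M} (h : Reach E ω α m ξ) (hm : m ∈ₘ ω) (hs : IsSucc s m)
    (hη : η = ξ ∨ E η ξ) : Reach E ω α s η :=
  fun X h₀ h₁ => h₁ m s ξ η hm hs (h X h₀ h₁) hη

variable [ModelsZF M] (hω : IsOmega ω)
include hω

theorem mono {n m ξ : M} (hn : n ∈ₘ ω) (hm : m ∈ₘ n) (h : Reach E ω α m ξ)
    [Dfb (fun v => E (v 0) (v 1))] : Reach E ω α n ξ := by
  refine hω.induction (fun n => m ∈ₘ n → Reach E ω α n ξ) ?_ ?_ hn hm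
  · exact fun e he hm => (he m hm).elim
  · intro n s hn ih hs hm
    rcases (hs m).1 hm with h' | rfl
    · exact (ih h').succ hn hs (.inl rfl)
    · exact h.succ hn hs (.inl rfl)

variable {κ : M} (hE : ∀ ξ η : M, ξ ∈ₘ κ → E η ξ → η ∈ₘ κ) (hα : α ∈ₘ κ)
include hE hα

/-- `Reach` quantifies over sets only, so `Q` is cut down to ω × κ; closure of κ under `E` keeps the
restricted relation closed. -/
theorem induction (Q : M → M → Prop) [Dfb (fun v => Q (v 0) (v 1))]
    (zero : ∀ e : M, (∀ z, ¬ z ∈ₘ e) → Q e α)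
    (succ : ∀ m s ξ η : M, m ∈ₘ ω → IsSucc s m → Q m ξ → η = ξ ∨ E η ξ → Q s η)
    {n ξ : M} (h : Reach E ω α n ξ) : Q n ξ := by
  obtain ⟨X, -, hX⟩ := exists_rel Q ω κ
  refine ((hX n ξ).1 (h X (fun e he => ?_) fun m s ξ η hm hs hξ hη => ?_)).2.2
  · obtain ⟨e', he'ω, he'⟩ := hω.1.1
    obtain rfl : e = e' := ext fun z => iff_of_false (he z) (he' z)
    exact (hX e α).2 ⟨he'ω, hα, zero e he⟩
  · obtain ⟨-, hξκ, hQ⟩ := (hX m ξ).1 hξ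
    refine (hX s η).2 ⟨hω.succ_mem hm hs, ?_, succ m s ξ η hm hs hQ hη⟩
    rcases hη with rfl | h
    · exact hξκ
    · exact hE ξ η hξκ h

theorem mem [Dfb (fun v => E (v 0) (v 1))] {n ξ : M} (h : Reach E ω α n ξ) : ξ ∈ₘ κ := by
  refine h.induction hω hE hα (fun _ ξ => ξ ∈ₘ κ) (fun _ _ => hα) ?_
  rintro m s ξ η - - hξ (rfl | h)
  · exact hξ
  · exact hE ξ η hξ h

theorem finClass [Dfb (fun v => E (v 0) (v 1))]
    (fin : ∀ ξ : M, ξ ∈ₘ κ → FinClass (fun η => E η ξ)) {n : M} (hn : n ∈ₘ ω) :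
    FinClass (fun ξ => Reach E ω α n ξ) := by
  have := Dfb.subst₂ E
  refine hω.induction (fun n => FinClass (fun ξ => Reach E ω α n ξ)) ?_ ?_ hn
  · intro e he
    refine (FinClass.of_eq α).mono fun ξ hξ => ?_
    refine hξ.induction hω hE hα (fun m ξ => m = e → ξ = α) (fun _ _ _ => rfl) ?_ rfl
    rintro m s ξ η - hs - - rfl
    exact (he m ((hs m).2 (.inr rfl))).elim
  · intro n s hn ih hs
    have hball : FinClass (fun η => ∃ ξ, Reach E ω α n ξ ∧ (η = ξ ∨ E η ξ)) :=
      ih.biUnion (fun ξ η => η = ξ ∨ E η ξ) fun ξ hξ =>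
        (FinClass.of_eq ξ).or (fin ξ (hξ.mem hω hE hα))
    refine hball.mono fun ξ hξ => ?_
    -- Inverting the last step needs the previous point to be reachable too, so `Reach` is carried
    -- along in the induction.
    refine (hξ.induction hω hE hα (fun m η => Reach E ω α m η ∧
      (m = s → ∃ ξ, Reach E ω α n ξ ∧ (η = ξ ∨ E η ξ))) ?_ ?_).2 rfl
    · rintro e he
      exact ⟨.zero he, fun h => (he n (h ▸ (hs n).2 (.inr rfl))).elim⟩
    · rintro m t ζ η hm ht ⟨hζ, -⟩ hη
      refine ⟨hζ.succ hm ht hη, fun hts => ?_⟩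
      subst hts
      obtain rfl := ht.inj hs
      exact ⟨ζ, hζ, hη⟩

end Reach

/-- Whatever reaches `ξ` reaches `η` one step later, so the least source cannot increase along an
arrow. -/
theorem IsRank.not_mem_of_edge {E : M → M → Prop} {κ ω : M} (hω : IsOmega ω)
    {ξ η α n β m : M} (hξ : IsRank E κ ω ξ β m) (hη : IsRank E κ ω η α n)
    (h : E η ξ) : ¬ β ∈ₘ α := by
  obtain ⟨s, hs, hsm⟩ := hω.1.2 m hξ.2.1
  exact fun hβ => hη.2.2.2.1 β hβ s hs (hξ.2.2.1.succ hξ.2.1 hsm (.inr h))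

variable [ModelsZF M]

section Rank

variable {E : M → M → Prop} {κ ω : M} (hω : IsOmega ω) (hκ : IsOrdinal κ)

include hω hκ

theorem exists_isRank [Dfb (fun v => E (v 0) (v 1))] {ξ : M} (hξ : ξ ∈ₘ κ) :
    ∃ α n : M, IsRank E κ ω ξ α n := by
  obtain ⟨e, heω, he⟩ := hω.1.1
  obtain ⟨α, hα, ⟨n, hn, hr⟩, hmin⟩ := exists_minimal (fun α => ∃ n, n ∈ₘ ω ∧ Reach E ω α n ξ)
    hξ ⟨e, heω, .zero he⟩
  obtain ⟨k, hk, hkr, hkmin⟩ := exists_minimal (fun n => Reach E ω α n ξ) hn hr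
  exact ⟨α, k, hα, hk, hkr, fun β hβ m hm h => hmin β (hκ.mem_of_mem hα hβ) ⟨m, hm, h⟩ hβ,
    fun m hm h => hkmin m (hω.mem_of_mem hk hm) h hm⟩

theorem IsRank.unique {ξ α n β m : M} (h : IsRank E κ ω ξ α n) (h' : IsRank E κ ω ξ β m) :
    α = β ∧ n = m := by
  have hαβ : α = β := by
    rcases hκ.2 α β h.1 h'.1 with k | k | k
    · exact (h'.2.2.2.1 α k n h.2.1 h.2.2.1).elim
    · exact k
    · exact (h.2.2.2.1 β k m h'.2.1 h'.2.2.1).elim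
  subst hαβ
  refine ⟨rfl, ?_⟩
  rcases hω.trichotomy h.2.1 h'.2.1 with k | k | k
  · exact (h.2.2.2.2 m k h'.2.2.1).elim
  · exact k.symm
  · exact (h'.2.2.2.2 n k h.2.2.1).elim

variable [Dfb (fun v => E (v 0) (v 1))]

theorem precedes_wellFounded (X x : M) (hX : Incl X κ) (hx : x ∈ₘ X) :
    ∃ y : M, y ∈ₘ X ∧ ∀ z : M, z ∈ₘ X → ¬ Precedes E κ ω z y := by
  obtain ⟨α, n, h⟩ := exists_isRank (E := E) hω hκ (hX x hx)
  obtain ⟨α, -, ⟨ξ, n, hξ, h⟩, hα⟩ := exists_minimal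
    (fun α => ∃ ξ, ∃ n, ξ ∈ₘ X ∧ IsRank E κ ω ξ α n) h.1 ⟨x, n, hx, h⟩
  obtain ⟨n, -, ⟨ξ, hξ, h⟩, hn⟩ := exists_minimal
    (fun n => ∃ ξ, ξ ∈ₘ X ∧ IsRank E κ ω ξ α n) h.2.1 ⟨ξ, hξ, h⟩
  obtain ⟨ξ, hξ, h, hmin⟩ := exists_minimal (fun ξ => IsRank E κ ω ξ α n) hξ h
  refine ⟨ξ, hξ, fun z hz ⟨_, α', n', β, m, hz', hξ', hlt⟩ => ?_⟩
  obtain ⟨rfl, rfl⟩ := h.unique hω hκ hξ'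
  rcases hlt with k | ⟨rfl, k | ⟨rfl, k⟩⟩
  · exact hα α' hz'.1 ⟨z, n', hz, hz'⟩ k
  · exact hn n' hz'.2.1 ⟨z, hz, hz'⟩ k
  · exact hmin z hz hz' k

/-- Earlier neighbours are targets of `ξ` or lie in the ball of radius `m` around the source `β` of
`ξ`; both sets are finite. -/
theorem precedes_finClass (hE : ∀ ξ η : M, ξ ∈ₘ κ → E η ξ → η ∈ₘ κ)
    (fin : ∀ ξ : M, ξ ∈ₘ κ → FinClass (fun η => E η ξ)) (ξ : M) (hξ : ξ ∈ₘ κ) :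
    FinClass (fun η => η ∈ₘ κ ∧ Precedes E κ ω η ξ) := by
  obtain ⟨β, m, hr⟩ := exists_isRank (E := E) hω hκ hξ
  refine ((fin ξ hξ).or (Reach.finClass hω hE hr.1 fin hr.2.1)).mono ?_
  rintro η ⟨-, hadj, α, n, β', m', hη, hξ', hlt⟩
  obtain ⟨rfl, rfl⟩ := hr.unique hω hκ hξ'
  rcases hadj with h | h
  · exact .inl h
  · rcases hlt with k | ⟨rfl, k | ⟨rfl, -⟩⟩
    · exact (hη.not_mem_of_edge hω hr h k).elim
    · exact .inr (hη.2.2.1.mono hω hr.2.1 k)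
    · exact .inr hη.2.2.1

theorem precedes_total {ξ η : M} (hξ : ξ ∈ₘ κ) (hη : η ∈ₘ κ) (hne : ξ ≠ η) (h : E η ξ) :
    Precedes E κ ω η ξ ∨ Precedes E κ ω ξ η := by
  obtain ⟨α, n, hα⟩ := exists_isRank (E := E) hω hκ hη
  obtain ⟨β, m, hβ⟩ := exists_isRank (E := E) hω hκ hξ
  have lt (k : α ∈ₘ β ∨ α = β ∧ (n ∈ₘ m ∨ n = m ∧ η ∈ₘ ξ)) : Precedes E κ ω η ξ :=
    ⟨.inl h, α, n, β, m, hα, hβ, k⟩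
  have gt (k : β ∈ₘ α ∨ β = α ∧ (m ∈ₘ n ∨ m = n ∧ ξ ∈ₘ η)) : Precedes E κ ω ξ η :=
    ⟨.inr h, β, m, α, n, hβ, hα, k⟩
  rcases hκ.2 α β hα.1 hβ.1 with k | k | k
  · exact .inl (lt (.inl k))
  · rcases hω.trichotomy hα.2.1 hβ.2.1 with l | l | l
    · exact .inr (gt (.inr ⟨k.symm, .inl l⟩))
    · rcases hκ.2 ξ η hξ hη with j | j | j
      · exact .inr (gt (.inr ⟨k.symm, .inr ⟨l, j⟩⟩))
      · exact (hne j).elim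
      · exact .inl (lt (.inr ⟨k, .inr ⟨l.symm, j⟩⟩))
    · exact .inl (lt (.inr ⟨k, .inl l⟩))
  · exact .inr (gt (.inl k))

/-- A graph on an ordinal with an orientation of finite out-degrees has countable chromatic
number. -/
theorem exists_coloring (hE : ∀ ξ η : M, ξ ∈ₘ κ → E η ξ → η ∈ₘ κ)
    (fin : ∀ ξ : M, ξ ∈ₘ κ → FinClass (fun η => E η ξ)) :
    ∃ c : M, IsFun c κ ω ∧ (∀ ξ n m : M, App c ξ n → m ∈ₘ n → ∃ η : M, App c η m) ∧
      ∀ ξ η n : M, ξ ≠ η → E η ξ → App c ξ n → ¬ App c η n := by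
  obtain ⟨c, hc, low, av⟩ := exists_greedy hω (Precedes E κ ω)
    (precedes_wellFounded hω hκ) (precedes_finClass hω hκ hE fin)
  refine ⟨c, hc, fun ξ n m h hm => (low ξ n m h hm).imp fun _ h => h.2.2,
    fun ξ η n hne h hξ hη => ?_⟩
  rcases precedes_total hω hκ (hc.mem hξ).1 (hc.mem hη).1 hne h with k | k
  · exact av ξ η n (hc.mem hη).1 k hξ hη
  · exact av η ξ n (hc.mem hξ).1 k hη hξ

end Rank

/-! ### Free colourings of set mappings and the two conclusions. -/

theorem IsSetMapping.finClass {F κ ω : M} (hω : IsOmega ω) (hF : IsSetMapping F κ ω) {ξ : M}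
    (hξ : ξ ∈ₘ κ) : FinClass (fun η => ∃ y : M, App F ξ y ∧ η ∈ₘ y) := by
  obtain ⟨s, hs, hF⟩ := hF
  obtain ⟨y, hy, huniq⟩ := hF.2 ξ hξ
  refine (hω.finClass_of_cardLt ((hs y).1 (hF.mem hy).2).2).mono ?_
  rintro η ⟨y', hy', hη⟩
  obtain rfl := huniq y' hy'
  exact hη

theorem IsSetMapping.mem {F κ ω ξ y η : M} (hF : IsSetMapping F κ ω) (hy : App F ξ y)
    (hη : η ∈ₘ y) : η ∈ₘ κ := by
  obtain ⟨s, hs, hF⟩ := hF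
  exact ((hs y).1 (hF.mem hy).2).1 η hη

/-- A surjective colouring of `κ` by natural numbers with free colour classes. -/
theorem IsSetMapping.exists_free_coloring {F κ ω : M} (hω : IsOmega ω) (hκ : IsOrdinal κ)
    (hκω : ¬ IsCountable κ) (hF : IsSetMapping F κ ω) :
    ∃ c : M, IsFun c κ ω ∧ (∀ n : M, n ∈ₘ ω → ∃ ξ : M, App c ξ n) ∧
      ∀ X n : M, (∀ ξ : M, ξ ∈ₘ X → App c ξ n) → IsFree F κ X := by
  obtain ⟨A, hAκ, hA, hseg⟩ :=
    exists_infinite_finite_mem_segments (not_finClass_of_not_isCountable hω hκ hκω)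
  obtain ⟨c, hc, low, av⟩ := exists_coloring hω hκ
    -- The second disjunct makes `A` a clique. It adds finitely many arrows at each point, since
    -- members of `A` have finite initial segments in κ.
    (E := fun η ξ => (∃ y, App F ξ y ∧ η ∈ₘ y) ∨ ξ ∈ₘ A ∧ η ∈ₘ ξ)
    (by
      rintro ξ η hξ (⟨y, hy, hη⟩ | ⟨-, h⟩)
      · exact hF.mem hy hη
      · exact hκ.mem_of_mem hξ h)
    (by
      refine fun ξ hξ => (hF.finClass hω hξ).or ?_
      by_cases h : ξ ∈ₘ A
      · exact (hseg ξ h).mono fun η hη => ⟨hκ.mem_of_mem hξ hη.2, hη.2⟩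
      · exact .of_false fun η hη => h hη.1)
  refine ⟨c, hc, fun n hn => hc.onto_of_initial hω low hAκ hA ?_ hn, fun X n hX => ?_⟩
  · intro ξ η n hξ hη hξn hηn
    rcases hκ.2 ξ η (hAκ ξ hξ) (hAκ η hη) with h | h | h
    · exact (av η ξ n (fun e => mem_irrefl ξ (e ▸ h)) (.inr ⟨hη, h⟩) hηn hξn).elim
    · exact h
    · exact (av ξ η n (fun e => mem_irrefl η (e ▸ h)) (.inr ⟨hξ, h⟩) hξn hηn).elim
  · exact ⟨fun ξ hξ => (hc.mem (hX ξ hξ)).1, fun α β hα hβ hne y hy hαy =>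
      av β α n hne.symm (.inl ⟨y, hy, hαy⟩) (hX β hβ) (hX α hα)⟩

/-- An uncountable ordinal is not a union of countably many finite sets. -/
theorem exists_infinite_fibre {κ ω c : M} (hω : IsOmega ω) (hκ : IsOrdinal κ)
    (hκω : ¬ IsCountable κ) (hc : IsFun c κ ω) :
    ∃ n : M, n ∈ₘ ω ∧ ¬ FinClass (fun ξ => App c ξ n) := by
  by_contra! hno
  suffices h : ∃ f, IsInj f κ ω ∧ (¬ FinClass (fun ξ => ξ ∈ₘ κ) → IsBij f κ ω) from
    h.elim fun f hf => hκω ⟨ω, f, hω, hf.1⟩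
  refine exists_isInj_of_finite_segments hω
    (fun η ξ => ∃ n, ∃ m, App c η n ∧ App c ξ m ∧ (n ∈ₘ m ∨ n = m ∧ η ∈ₘ ξ)) ?_ ?_ ?_
  · intro X x hX hx
    obtain ⟨n, hn, -⟩ := hc.2 x (hX x hx)
    obtain ⟨n, -, ⟨ξ, hξ, h⟩, hmin⟩ := exists_minimal (fun n => ∃ ξ, ξ ∈ₘ X ∧ App c ξ n)
      (hc.mem hn).2 ⟨x, hx, hn⟩
    obtain ⟨ξ, hξ, h, hmin'⟩ := exists_minimal (fun ξ => App c ξ n) hξ h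
    refine ⟨ξ, hξ, fun z hz ⟨k, m, hk, hm, hlt⟩ => ?_⟩
    obtain rfl := hc.unique h hm
    rcases hlt with l | ⟨rfl, l⟩
    · exact hmin k (hc.mem hk).2 ⟨z, hz, hk⟩ l
    · exact hmin' z hz hk l
  · intro ξ hξ
    obtain ⟨m, hm, -⟩ := hc.2 ξ hξ
    have hmω := (hc.mem hm).2
    -- The initial segment of `ξ` is covered by the fibres of the finitely many colours up to `m`.
    have hle : FinClass (fun n => n ∈ₘ m ∨ n = m) :=
      FinClass.or ⟨m, hω.kFinite hmω, fun _ => id⟩ (.of_eq m)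
    refine (hle.biUnion (fun n η => App c η n) ?_).mono ?_
    · rintro n (hn | rfl)
      · exact hno n (hω.mem_of_mem hmω hn)
      · exact hno n hmω
    · rintro η ⟨-, n, m', hn, hm', hlt⟩
      obtain rfl := hc.unique hm hm'
      exact ⟨n, hlt.imp id And.left, hn⟩
  · intro ξ η hξ hη
    obtain ⟨n, hn, -⟩ := hc.2 ξ hξ
    obtain ⟨m, hm, -⟩ := hc.2 η hη
    rcases hω.trichotomy (hc.mem hn).2 (hc.mem hm).2 with h | rfl | h
    · exact .inr (.inr ⟨m, n, hm, hn, .inl h⟩)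
    · rcases hκ.2 ξ η hξ hη with h | h | h
      · exact .inl ⟨_, _, hn, hm, .inr ⟨rfl, h⟩⟩
      · exact .inr (.inl h)
      · exact .inr (.inr ⟨_, _, hm, hn, .inr ⟨rfl, h⟩⟩)
    · exact .inl ⟨n, m, hn, hm, .inl h⟩

/-- An infinite colour class may be too large; its infinite subset with finite initial segments is
in bijection with ω. -/
theorem free_of_not_isCountable {κ ω : M} (hω : IsOmega ω) (hκ : IsOrdinal κ)
    (hκω : ¬ IsCountable κ) : Free κ ω ω := by
  intro F hF
  obtain ⟨c, hc, -, hfree⟩ := hF.exists_free_coloring hω hκ hκω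
  obtain ⟨n, -, hinf⟩ := exists_infinite_fibre hω hκ hκω hc
  obtain ⟨X, hX⟩ := exists_sep (fun ξ => App c ξ n) κ
  obtain ⟨A, hAX, hA, hseg⟩ := exists_infinite_finite_mem_segments (X := X)
    fun h => hinf (h.mono fun ξ hξ => (hX ξ).2 ⟨(hc.mem hξ).1, hξ⟩)
  obtain ⟨f, -, hf⟩ := exists_isInj_of_finite_mem_segments hω hκ
    (fun ξ hξ => ((hX ξ).1 (hAX ξ hξ)).1)
    fun ξ hξ => (hseg ξ hξ).mono fun η hη => ⟨hAX η hη.1, hη.2⟩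
  exact ⟨A, hfree A n fun ξ hξ => ((hX ξ).1 (hAX ξ hξ)).2, f, hf hA⟩

theorem freeUnion_of_not_isCountable {κ ω : M} (hω : IsOmega ω) (hκ : IsOrdinal κ)
    (hκω : ¬ IsCountable κ) : FreeUnion κ ω ω := by
  intro F hF
  obtain ⟨c, hc, honto, hfree⟩ := hF.exists_free_coloring hω hκ hκω
  obtain ⟨p, hp⟩ := ModelsZF.powerset κ
  obtain ⟨P, hP⟩ := exists_sep (fun X => ∃ n, n ∈ₘ ω ∧ ∀ ξ, ξ ∈ₘ X ↔ App c ξ n) p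
  have fibre : ∀ n, n ∈ₘ ω → ∃ X, X ∈ₘ P ∧ ∀ ξ, ξ ∈ₘ X ↔ App c ξ n := by
    intro n hn
    obtain ⟨X, hX⟩ := exists_sep (fun ξ => App c ξ n) κ
    have hX' : ∀ ξ, ξ ∈ₘ X ↔ App c ξ n := fun ξ =>
      (hX ξ).trans ⟨And.right, fun h => ⟨(hc.mem h).1, h⟩⟩
    exact ⟨X, (hP X).2 ⟨(hp X).2 fun ξ hξ => ((hX ξ).1 hξ).1, n, hn, hX'⟩, hX'⟩
  refine ⟨P, ⟨fun X hX => ?_, fun X Y hX hY hne ξ hξ hξ' => ?_, fun ξ => ⟨fun hξ => ?_, ?_⟩⟩, ?_,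
    fun X hX => ?_⟩
  · obtain ⟨-, n, hn, hXn⟩ := (hP X).1 hX
    obtain ⟨ξ, hξ⟩ := honto n hn
    exact ⟨ξ, (hXn ξ).2 hξ⟩
  · obtain ⟨-, n, hn, hXn⟩ := (hP X).1 hX
    obtain ⟨-, m, hm, hYm⟩ := (hP Y).1 hY
    obtain rfl := hc.unique ((hXn ξ).1 hξ) ((hYm ξ).1 hξ')
    exact hne (ext fun z => (hXn z).trans (hYm z).symm)
  · obtain ⟨n, hn, -⟩ := hc.2 ξ hξ
    obtain ⟨X, hX, hXn⟩ := fibre n (hc.mem hn).2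
    exact ⟨X, hX, (hXn ξ).2 hn⟩
  · rintro ⟨X, hX, hξ⟩
    exact (hp X).1 ((hP X).1 hX).1 ξ hξ
  -- Each class is sent to its colour, which is unique because surjectivity of `c` makes the class
  -- nonempty.
  · obtain ⟨f, hf, hfQ⟩ := exists_rel (fun X n => ∀ ξ, ξ ∈ₘ X ↔ App c ξ n) P ω
    refine ⟨f, ⟨⟨⟨hf, fun X hX => ?_⟩, fun X Y n h h' => ?_⟩, fun n hn => ?_⟩⟩
    · obtain ⟨-, n, hn, hXn⟩ := (hP X).1 hX
      refine ⟨n, (hfQ X n).2 ⟨hX, hn, hXn⟩, fun m hm => ?_⟩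
      obtain ⟨ξ, hξ⟩ := honto n hn
      exact hc.unique ((((hfQ X m).1 hm).2.2 ξ).1 ((hXn ξ).2 hξ)) hξ
    · exact ext fun z => (((hfQ X n).1 h).2.2 z).trans (((hfQ Y n).1 h').2.2 z).symm
    · obtain ⟨X, hX, hXn⟩ := fibre n hn
      exact ⟨X, (hfQ X n).2 ⟨hX, hn, hXn⟩⟩
  · obtain ⟨-, n, -, hXn⟩ := (hP X).1 hX
    exact hfree X n fun ξ => (hXn ξ).1

end ZFModel

theorem mainTheorem7 (M : Type*) [setLang.Structure M] [ZFModel.ModelsZF M] :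
    ∃ ω : M, ZFModel.IsOmega ω ∧
      ∀ κ : M, ZFModel.IsCardinal κ → ¬ ZFModel.IsCountable κ →
        ZFModel.Free κ ω ω ∧ ZFModel.FreeUnion κ ω ω := by
  obtain ⟨ω, hω⟩ := ZFModel.exists_isOmega (M := M)
  exact ⟨ω, hω, fun κ hκ hκω => ⟨ZFModel.free_of_not_isCountable hω hκ.1 hκω,
    ZFModel.freeUnion_of_not_isCountable hω hκ.1 hκω⟩⟩
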